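/- Let $G$ be a group acting on a set $X$ and let $\mathcal I$ be a $G$-invariant Boolean ideal on $X$, that is, a proper ideal of the Boolean algebra of all subsets of $X$ such that $gA\in\mathcal I$ for all $g\in G$, $A\in\mathcal I$. For a set $Y$ let $P(Y)$ be the set of all finitely additive probability measures defined on all subsets of $Y$, and put $P_{\mathcal I}(X)=\{\nu\in P(X):\nu(A)=0\text{ for all }A\in\mathcal I\}$. For a subgroup $H\le G$, $\lambda\in P(H)$ and $\nu\in P(X)$ the convolution $\lambda*\nu\in P(X)$ is defined by $(\lambda*\nu)(A)=\int_H\nu(h^{-1}A)\,d\lambda(h)$; $\delta_x$ is the Dirac measure at $x$. For $\mu\in P(X)$ put $$P_{\mathcal I}(H;\mu)=\{\lambda\in P(H):\lambda*\delta_x*\mu\in P_{\mathcal I}(X)\text{ for all }x\in H\}.$$ Let $\mathcal H$ be the family of all countable subgroups of $G$. A family $\mathcal C\subseteq\mathcal H$ is closed if $\bigcup_{k}H_k\in\mathcal C$ for every increasing sequence $(H_k)_{k\in\omega}$ of members of $\mathcal C$; it is dominating if every $H\in\mathcal H$ is contained in some member of $\mathcal C$. A family $\mathcal F\subseteq\mathcal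 H$ is stationary if $\mathcal F\cap\mathcal C\ne\emptyset$ for every closed dominating $\mathcal C\subseteq\mathcal H$. For $A\subseteq X$ let $\Delta_{\mathcal I}(A)=\{g\in G:gA\cap A\notin\mathcal I\}$. For $B\subseteq G$ and a Boolean ideal $\mathcal J$ on $G$ let $\mathrm{cov}(B)=\min\{|F|:F\subseteq G,\ FB=G\}$ and $\mathrm{cov}_{\mathcal J}(B)=\min\{|F|:F\subseteq G,\ G\setminus FB\in\mathcal J\}$, where both are $\infty$ (larger than every cardinal) for $B=\emptyset$. Theorem. Let $\mu\in P(X)$ be such that $\{H\in\mathcal H:P_{\mathcal I}(H;\mu)\ne\emptyset\}$ is stationary. Then for every partition $X=A_1\cup\dots\cup A_n$ into pairwise disjoint sets, either 1. $\mathrm{cov}(\Delta_{\mathcal I}(A_i))\le n$ for all $i\in\{1,\dots,n\}$, or else 2. there are $i\in\{1,\dots,n\}$ and a $G$-invariant Boolean ideal $\mathcal J$ on $G$ (a proper ideal of subsets of $G$ invariant under left translations) such that $\{x\in G:\mu(xA_i)>\frac1n\}\notin\mathcal J$ and $\mathrm{cov}_{\mathcal J}(\Delta_{\mathcal I}(A_i))<n$.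 -/

import Mathlib

open scoped Pointwise NNReal

namespace IdealGSpace

/-- Finitely additive probability measures defined on all subsets of `X`. -/
structure FinAddProb (X : Type*) extends
    MeasureTheory.AddContent ℝ≥0 (Set.univ : Set (Set X)) where
  univ' : toFun Set.univ = 1

namespace FinAddProb

variable {X : Type*}

instance : CoeFun (FinAddProb X) (fun _ => Set X → ℝ≥0) := ⟨fun m => m.toFun⟩

lemma isSetRing_univ : MeasureTheory.IsSetRing (Set.univ : Set (Set X)) :=
  ⟨trivial, fun _ _ _ _ => trivial, fun _ _ _ _ => trivial⟩

/-- Build a finitely additive probability measure from additivity on two disjoint sets. -/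
noncomputable def ofUnion (f : Set X → ℝ≥0) (h0 : f ∅ = 0) (h1 : f Set.univ = 1)
    (hU : ∀ s t, Disjoint s t → f (s ∪ t) = f s + f t) : FinAddProb X where
  toAddContent := isSetRing_univ.addContent_of_union f h0 (fun _ _ h => hU _ _ h)
  univ' := h1

lemma empty (m : FinAddProb X) : m ∅ = 0 := m.empty'

lemma union (m : FinAddProb X) {s t : Set X} (h : Disjoint s t) : m (s ∪ t) = m s + m t :=
  MeasureTheory.addContent_union (m := m.toAddContent) isSetRing_univ trivial trivial h

lemma sum_fiber (m : FinAddProb X) {ι : Type} [Fintype ι] (p : X → ι) (s : Set X) :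
    m s = ∑ i, m (s ∩ p ⁻¹' {i}) := by
  have h := MeasureTheory.addContent_biUnion (m := m.toAddContent) (a := Finset.univ)
    (f := fun i => s ∩ p ⁻¹' {i}) (fun _ _ => trivial)
    (by
      intro i _ j _ hij
      refine Set.disjoint_left.2 ?_
      rintro x ⟨_, hx⟩ ⟨_, hy⟩
      exact hij (by simp_all)) trivial
  have e : (⋃ i ∈ (Finset.univ : Finset ι), s ∩ p ⁻¹' {i}) = s := by
    ext x; simp
  rw [e] at h
  exact h

/-- `∑ i, c i * m (p ⁻¹' {i})`, the integral of the finitely valued function `c ∘ p`. -/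
noncomputable def simpleSum (m : FinAddProb X) {ι : Type} [Fintype ι] (p : X → ι) (c : ι → ℝ) :
    ℝ :=
  ∑ i, c i * (m (p ⁻¹' {i}) : ℝ)

/-- The integrals of the finitely valued functions lying below `f`. -/
def lowerSums (m : FinAddProb X) (f : X → ℝ) : Set ℝ :=
  {r | ∃ (ι : Type) (_ : Fintype ι) (p : X → ι) (c : ι → ℝ),
    (∀ x, c (p x) ≤ f x) ∧ r = m.simpleSum p c}

/-- The integral of a bounded function `f : X → ℝ` against a finitely additive probability
measure: the supremum of the integrals of finitely valued functions below `f`. -/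
noncomputable def integral (m : FinAddProb X) (f : X → ℝ) : ℝ := sSup (m.lowerSums f)

section IntegralFacts

variable (m : FinAddProb X)

lemma simpleSum_fst {ι κ : Type} [Fintype ι] [Fintype κ] (p : X → ι) (q : X → κ) (c : ι → ℝ) :
    m.simpleSum (fun x => (p x, q x)) (fun z => c z.1) = m.simpleSum p c := by
  unfold simpleSum
  rw [Fintype.sum_prod_type]
  refine Finset.sum_congr rfl fun i _ => ?_
  rw [m.sum_fiber q (p ⁻¹' {i}), NNReal.coe_sum, Finset.mul_sum]
  refine Finset.sum_congr rfl fun j _ => ?_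
  congr 3
  ext x; simp

lemma simpleSum_snd {ι κ : Type} [Fintype ι] [Fintype κ] (p : X → ι) (q : X → κ) (c : κ → ℝ) :
    m.simpleSum (fun x => (p x, q x)) (fun z => c z.2) = m.simpleSum q c := by
  unfold simpleSum
  rw [Fintype.sum_prod_type_right]
  refine Finset.sum_congr rfl fun j _ => ?_
  rw [m.sum_fiber p (q ⁻¹' {j}), NNReal.coe_sum, Finset.mul_sum]
  refine Finset.sum_congr rfl fun i _ => ?_
  congr 3
  ext x; simp [and_comm]

lemma simpleSum_mono' {ι : Type} [Fintype ι] (p : X → ι) (c d : ι → ℝ)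
    (h : ∀ x, c (p x) ≤ d (p x)) : m.simpleSum p c ≤ m.simpleSum p d := by
  refine Finset.sum_le_sum fun i _ => ?_
  by_cases hi : ∃ x, p x = i
  · obtain ⟨x, rfl⟩ := hi
    exact mul_le_mul_of_nonneg_right (h x) (NNReal.coe_nonneg _)
  · have : p ⁻¹' {i} = ∅ := by
      ext x; simpa using fun hx => hi ⟨x, hx⟩
    simp [this, m.empty]

lemma simpleSum_mono {ι κ : Type} [Fintype ι] [Fintype κ] (p : X → ι) (q : X → κ) (c : ι → ℝ)
    (d : κ → ℝ) (h : ∀ x, c (p x) ≤ d (q x)) : m.simpleSum p c ≤ m.simpleSum q d := by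
  rw [← m.simpleSum_fst p q c, ← m.simpleSum_snd p q d]
  exact m.simpleSum_mono' _ _ _ h

lemma simpleSum_add {ι κ : Type} [Fintype ι] [Fintype κ] (p : X → ι) (q : X → κ) (c : ι → ℝ)
    (d : κ → ℝ) : m.simpleSum (fun x => (p x, q x)) (fun z => c z.1 + d z.2) =
      m.simpleSum p c + m.simpleSum q d := by
  rw [← m.simpleSum_fst p q c, ← m.simpleSum_snd p q d]
  simp only [simpleSum, add_mul, Finset.sum_add_distrib]

lemma simpleSum_const (b : ℝ) : m.simpleSum (fun _ : X => ()) (fun _ => b) = b := by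
  have h : m (Set.univ : Set X) = 1 := m.univ'
  simp [simpleSum, h]

lemma lowerSums_le {f : X → ℝ} {b r : ℝ} (hb : ∀ x, f x ≤ b) (hr : r ∈ m.lowerSums f) : r ≤ b := by
  obtain ⟨ι, _, p, c, hc, rfl⟩ := hr
  rw [← m.simpleSum_const b]
  exact m.simpleSum_mono _ _ _ _ fun x => (hc x).trans (hb x)

lemma mem_lowerSums_of_le {f : X → ℝ} {a : ℝ} (ha : ∀ x, a ≤ f x) : a ∈ m.lowerSums f :=
  ⟨Unit, inferInstance, fun _ => (), fun _ => a, ha, (m.simpleSum_const a).symm⟩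

lemma bddAbove_lowerSums {f : X → ℝ} {b : ℝ} (hb : ∀ x, f x ≤ b) : BddAbove (m.lowerSums f) :=
  ⟨b, fun _ hr => m.lowerSums_le hb hr⟩

lemma integral_const (b : ℝ) : m.integral (fun _ => b) = b :=
  le_antisymm
    (csSup_le ⟨b, m.mem_lowerSums_of_le fun _ => le_rfl⟩
      fun _ hr => m.lowerSums_le (fun _ => le_rfl) hr)
    (le_csSup (m.bddAbove_lowerSums fun _ => le_rfl) (m.mem_lowerSums_of_le fun _ => le_rfl))

lemma integral_nonneg {f : X → ℝ} {b : ℝ} (h0 : ∀ x, 0 ≤ f x) (hb : ∀ x, f x ≤ b) :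
    0 ≤ m.integral f :=
  le_csSup (m.bddAbove_lowerSums hb) (m.mem_lowerSums_of_le h0)

/-- A function with values in `[0, b]` is uniformly approximated by finitely valued ones. -/
lemma exists_approx {f : X → ℝ} {b : ℝ} (h0 : ∀ x, 0 ≤ f x) (hb : ∀ x, f x ≤ b) {ε : ℝ}
    (hε : 0 < ε) : ∃ (ι : Type) (_ : Fintype ι) (p : X → ι) (c : ι → ℝ),
      (∀ x, c (p x) ≤ f x) ∧ ∀ x, f x ≤ c (p x) + ε := by
  refine ⟨Fin (⌊b / ε⌋₊ + 1), inferInstance, fun x => ⟨⌊f x / ε⌋₊, ?_⟩, fun i => (i : ℕ) * ε,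
    fun x => ?_, fun x => ?_⟩
  · exact Nat.lt_succ_of_le (Nat.floor_le_floor (div_le_div_of_nonneg_right (hb x) hε.le))
  · have := Nat.floor_le (div_nonneg (h0 x) hε.le)
    exact (le_div_iff₀ hε).1 this
  · have := (Nat.lt_floor_add_one (f x / ε)).le
    have := (div_le_iff₀ hε).1 this
    simpa [add_mul] using this

lemma integral_add {f g : X → ℝ} {b b' : ℝ} (hf0 : ∀ x, 0 ≤ f x) (hfb : ∀ x, f x ≤ b)
    (hg0 : ∀ x, 0 ≤ g x) (hgb : ∀ x, g x ≤ b') :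
    m.integral (fun x => f x + g x) = m.integral f + m.integral g := by
  have hbd : BddAbove (m.lowerSums fun x => f x + g x) :=
    m.bddAbove_lowerSums (b := b + b') fun x => add_le_add (hfb x) (hgb x)
  apply le_antisymm
  · refine csSup_le ⟨0, m.mem_lowerSums_of_le fun x => add_nonneg (hf0 x) (hg0 x)⟩ ?_
    rintro _ ⟨ι, _, p, c, hc, rfl⟩
    refine le_of_forall_pos_le_add fun ε hε => ?_
    obtain ⟨κ, _, q, d, hd, hd'⟩ := exists_approx hf0 hfb (half_pos hε)
    obtain ⟨τ, _, s, e, he, he'⟩ := exists_approx hg0 hgb (half_pos hε)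
    have h1 : m.simpleSum q d ≤ m.integral f :=
      le_csSup (m.bddAbove_lowerSums hfb) ⟨κ, _, q, d, hd, rfl⟩
    have h2 : m.simpleSum s e ≤ m.integral g :=
      le_csSup (m.bddAbove_lowerSums hgb) ⟨τ, _, s, e, he, rfl⟩
    have h3 := m.simpleSum_add (fun x => (q x, s x)) (fun _ => ()) (fun z => d z.1 + e z.2)
      (fun _ => ε)
    rw [m.simpleSum_add, m.simpleSum_const] at h3
    have h4 := m.simpleSum_mono p (fun x => ((q x, s x), ())) c
      (fun z => d z.1.1 + e z.1.2 + ε) fun x => by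
        have := hc x; have := hd' x; have := he' x; simp only; linarith
    linarith
  · rw [← le_sub_iff_add_le]
    refine csSup_le ⟨0, m.mem_lowerSums_of_le hf0⟩ ?_
    rintro _ ⟨ι, _, p, c, hc, rfl⟩
    rw [le_sub_comm]
    refine csSup_le ⟨0, m.mem_lowerSums_of_le hg0⟩ ?_
    rintro _ ⟨κ, _, q, d, hd, rfl⟩
    rw [le_sub_iff_add_le, add_comm, ← m.simpleSum_add]
    exact le_csSup hbd ⟨ι × κ, inferInstance, _, _, fun x => add_le_add (hc x) (hd x), rfl⟩

end IntegralFacts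

lemma le_one (m : FinAddProb X) (s : Set X) : m s ≤ 1 := by
  have h : m (Set.univ : Set X) = 1 := m.univ'
  rw [← h, ← Set.union_compl_self s, m.union disjoint_compl_right]
  exact le_self_add

/-- The Dirac measure at `a`. -/
noncomputable def dirac (a : X) : FinAddProb X := by
  classical
  exact ofUnion (fun s => if a ∈ s then 1 else 0) (by simp) (by simp) (by
    intro s t h
    have hd : a ∈ s → a ∉ t := fun hs => Set.disjoint_left.1 h hs
    by_cases h1 : a ∈ s <;> by_cases h2 : a ∈ t <;> simp_all)

/-- The convolution `l * m` of a measure `l` on the group `G` and a measure `m` on the `G`-space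
`X`: `(l * m) A = ∫ m (g⁻¹ A) dl(g)`. -/
noncomputable def conv {G : Type*} [Group G] [MulAction G X] (l : FinAddProb G)
    (m : FinAddProb X) : FinAddProb X :=
  ofUnion
    (fun A => ⟨l.integral (fun g => (m (g⁻¹ • A) : ℝ)),
      l.integral_nonneg (b := 1) (fun _ => NNReal.coe_nonneg _)
        (fun _ => by exact_mod_cast m.le_one _)⟩)
    (by
      apply NNReal.eq
      simp only [Set.smul_set_empty, m.empty]
      exact l.integral_const 0)
    (by
      have h : m (Set.univ : Set X) = 1 := m.univ'
      apply NNReal.eq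
      simp only [Set.smul_set_univ, h]
      exact l.integral_const 1)
    (by
      intro s t hst
      apply NNReal.eq
      have : ∀ g : G, m (g⁻¹ • (s ∪ t)) = m (g⁻¹ • s) + m (g⁻¹ • t) := fun g => by
        rw [Set.smul_set_union]
        exact m.union ((Set.disjoint_image_iff (MulAction.injective _)).2 hst)
      simp only [this, NNReal.coe_add]
      exact l.integral_add (b := 1) (b' := 1)
        (fun _ => NNReal.coe_nonneg _) (fun _ => by exact_mod_cast m.le_one _)
        (fun _ => NNReal.coe_nonneg _) (fun _ => by exact_mod_cast m.le_one _))

end FinAddProb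

/-- `G`-invariance of an ideal of subsets of a `G`-space. -/
def IsGInvariant (G : Type*) [Group G] {X : Type*} [MulAction G X]
    (I : Order.Ideal (Set X)) : Prop :=
  ∀ g : G, ∀ A ∈ I, g • A ∈ I

/-- The `I`-difference set `{g ∈ G : gA ∩ A ∉ I}`. -/
def diffSet (G : Type*) [Group G] {X : Type*} [MulAction G X]
    (I : Order.Ideal (Set X)) (A : Set X) : Set G :=
  {g | g • A ∩ A ∉ I}

/-- The covering number `min {|F| : F ⊆ G, G = F A}`, a cardinal or `∞ = ⊤` (for `A = ∅`). -/
noncomputable def cov {G : Type*} [Group G] (A : Set G) : WithTop Cardinal :=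
  ⨅ F ∈ {F : Set G | F * A = Set.univ}, ((Cardinal.mk F : Cardinal) : WithTop Cardinal)

/-- The `J`-covering number `min {|F| : F ⊆ G, F A =_J G}`; for a proper ideal `J` it is
`∞ = ⊤` at `A = ∅`. -/
noncomputable def covIdeal {G : Type*} [Group G] (J : Order.Ideal (Set G)) (A : Set G) :
    WithTop Cardinal :=
  ⨅ F ∈ {F : Set G | symmDiff (F * A) Set.univ ∈ J},
    ((Cardinal.mk F : Cardinal) : WithTop Cardinal)

/-- `P_I(X)`: the finitely additive probability measures on `X` vanishing on `I`. -/
def nullMeasures {X : Type*} (I : Order.Ideal (Set X)) : Set (FinAddProb X) :=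
  {m | ∀ A ∈ I, m A = 0}

/-- `P_I(H; μ) = {l ∈ P(H) : l * δ_x * μ ∈ P_I(X) for all x ∈ H}`. -/
def convNullMeasures {G : Type*} [Group G] {X : Type*} [MulAction G X]
    (I : Order.Ideal (Set X)) (H : Subgroup G) (μ : FinAddProb X) : Set (FinAddProb H) :=
  {l | ∀ x : H, l.conv ((FinAddProb.dirac x).conv μ) ∈ nullMeasures I}

/-- The family of all countable subgroups of `G`. -/
def countableSubgroups (G : Type*) [Group G] : Set (Subgroup G) :=
  {H | Countable H}

/-- Closed families of subgroups: closed under unions of increasing sequences. -/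
def IsClosedFamily {G : Type*} [Group G] (F : Set (Subgroup G)) : Prop :=
  ∀ s : ℕ → Subgroup G, Monotone s → (∀ k, s k ∈ F) →
    ∀ K : Subgroup G, (K : Set G) = ⋃ k, (s k : Set G) → K ∈ F

/-- Dominating families: every countable subgroup lies in a member of the family. -/
def IsDominatingFamily {G : Type*} [Group G] (F : Set (Subgroup G)) : Prop :=
  ∀ H ∈ countableSubgroups G, ∃ K ∈ F, H ≤ K

/-- Stationary families: those meeting every closed dominating family of countable subgroups. -/
def IsStationaryFamily {G : Type*} [Group G] (F : Set (Subgroup G)) : Prop :=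
  ∀ C ⊆ countableSubgroups G, IsClosedFamily C → IsDominatingFamily C → (F ∩ C).Nonempty

end IdealGSpace

open IdealGSpace

/-!
Measures live in the product space `Set X → ℝ`. If `l * μ` vanishes on `I`, so does every measure
in its closed convex orbit hull, and by compactness this hull contains a measure `ν` whose own orbit
hull is minimal; `ν` is also in the orbit hull of `μ`. If `ν A > r`, then some `y` satisfies
`μ (y A) > r` and `ν (z y A) > r` for all `z` in a given finite set: otherwise a convex combination
of `ν` and an average of its translates over `z` would force `ν (g A)` to stay strictly below its
supremum over `g`.

Suppose that both alternatives fail. Since `cov Δ(A i) > n`, there are `n + 1` translates of `A i`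
pairwise disjoint modulo `I`, so one of them has `ν`-measure less than `1 / n`, and for the same
translation some `f A j` has `ν`-measure greater than `1 / n`. For `|F| < n`, the invariant ideal
generated by the complement of `F Δ(A j)` is not a `J` as in the second alternative, so for a
finite set `E F` every `y` with `μ (y A j) > 1 / n` has `y ∉ e F Δ(A j)` for some `e ∈ E F`.
Stationarity provides a countable subgroup that is closed under these operations and carries such
an `l`. Starting from `f`, recurrence then produces one after the other `n` translates of `A j`
that are pairwise disjoint modulo `I` and of `ν`-measure greater than `1 / n`, which is absurd.
-/

namespace IdealGSpace

section AffineDynamics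

variable (Γ : Type*) {V : Type*} [Monoid Γ] [AddCommGroup V] [Module ℝ V] [TopologicalSpace V]
  [DistribMulAction Γ V]

/-- The smallest closed convex set containing the `Γ`-orbit of `v`. -/
def orbitHull (v : V) : Set V := closedConvexHull ℝ (MulAction.orbit Γ v)

/-- The affine analogue of a uniformly recurrent point: `v` can be recovered from every point `w`
of its orbit hull, so that this hull is minimal among the nonempty closed convex invariant sets. -/
def IsHullMinimal (v : V) : Prop := ∀ w ∈ orbitHull Γ v, v ∈ orbitHull Γ w

variable {Γ}

lemma smul_mem_orbitHull (g : Γ) (v : V) : g • v ∈ orbitHull Γ v :=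
  subset_closedConvexHull (MulAction.mem_orbit v g)

lemma self_mem_orbitHull (v : V) : v ∈ orbitHull Γ v :=
  subset_closedConvexHull (MulAction.mem_orbit_self v)

lemma orbitHull_subset {v : V} {s : Set V} (hconv : Convex ℝ s) (hclosed : IsClosed s)
    (hs : ∀ g : Γ, g • v ∈ s) : orbitHull Γ v ⊆ s :=
  closedConvexHull_min (Set.range_subset_iff.2 hs) hconv hclosed

lemma isClosed_orbitHull (v : V) : IsClosed (orbitHull Γ v) := isClosed_closedConvexHull

lemma convex_orbitHull (v : V) : Convex ℝ (orbitHull Γ v) := convex_closedConvexHull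

lemma apply_le_of_mem_orbitHull (F : V →L[ℝ] ℝ) {v w : V} {c : ℝ} (hv : ∀ g : Γ, F (g • v) ≤ c)
    (hw : w ∈ orbitHull Γ v) : F w ≤ c :=
  orbitHull_subset (s := {x | F x ≤ c}) (convex_halfSpace_le F.toLinearMap.isLinear c)
    (isClosed_le F.continuous continuous_const) hv hw

lemma exists_prodMk_mem_orbitHull [T2Space V] {v v' w : V} (hv : IsCompact (orbitHull Γ v))
    (hv' : IsCompact (orbitHull Γ v')) (hw : w ∈ orbitHull Γ v) :
    ∃ w' ∈ orbitHull Γ v', (w, w') ∈ orbitHull Γ (v, v') := by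
  have hsub : orbitHull Γ (v, v') ⊆ orbitHull Γ v ×ˢ orbitHull Γ v' :=
    orbitHull_subset ((convex_orbitHull v).prod (convex_orbitHull v'))
      ((isClosed_orbitHull v).prod (isClosed_orbitHull v'))
      fun g => ⟨smul_mem_orbitHull g v, smul_mem_orbitHull g v'⟩
  have hcompact : IsCompact (orbitHull Γ (v, v')) :=
    (hv.prod hv').of_isClosed_subset (isClosed_orbitHull _) hsub
  have hfst : orbitHull Γ v ⊆ Prod.fst '' orbitHull Γ (v, v') :=
    orbitHull_subset ((convex_orbitHull _).is_linear_image (LinearMap.fst ℝ V V).isLinear)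
      (hcompact.image continuous_fst).isClosed
      fun g => ⟨_, smul_mem_orbitHull g (v, v'), rfl⟩
  obtain ⟨⟨_, w'⟩, hmem, rfl⟩ := hfst hw
  exact ⟨w', (hsub hmem).2, hmem⟩

lemma exists_mem_orbitHull_card_mul_apply [SMulCommClass Γ ℝ V] (v : V) {Z : Finset Γ}
    (hZ : Z.Nonempty) : ∃ m ∈ orbitHull Γ v, ∀ (F : V →L[ℝ] ℝ) (g : Γ),
      Z.card * F (g • m) = ∑ z ∈ Z, F (g • z • v) := by
  have hcard : (Z.card : ℝ) ≠ 0 := by exact_mod_cast hZ.card_pos.ne'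
  refine ⟨∑ z ∈ Z, (Z.card : ℝ)⁻¹ • z • v, ?_, fun F g => ?_⟩
  · exact (convex_orbitHull v).sum_mem (fun _ _ => by positivity) (by simp [hcard])
      fun z _ => smul_mem_orbitHull z v
  · simp only [Finset.smul_sum, smul_comm g, map_sum, map_smul, smul_eq_mul, ← Finset.mul_sum]
    rw [mul_inv_cancel_left₀ hcard]

section Minimal

variable [ContinuousConstSMul Γ V] [SMulCommClass Γ ℝ V]

lemma smul_mem_orbitHull_of_mem (g : Γ) {v w : V} (hw : w ∈ orbitHull Γ v) :
    g • w ∈ orbitHull Γ v := by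
  refine orbitHull_subset (s := (g • ·) ⁻¹' orbitHull Γ v) ?_ ?_ (fun h => ?_) hw
  · exact (convex_orbitHull v).linear_preimage (DistribSMul.toLinearMap ℝ V g)
  · exact (isClosed_orbitHull v).preimage (continuous_const_smul g)
  · simpa only [Set.mem_preimage, smul_smul] using smul_mem_orbitHull (g * h) v

lemma orbitHull_subset_of_mem {v w : V} (hw : w ∈ orbitHull Γ v) :
    orbitHull Γ w ⊆ orbitHull Γ v :=
  orbitHull_subset (convex_orbitHull v) (isClosed_orbitHull v)
    fun g => smul_mem_orbitHull_of_mem g hw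

lemma exists_isHullMinimal {v : V} (hv : IsCompact (orbitHull Γ v)) :
    ∃ w ∈ orbitHull Γ v, IsHullMinimal Γ w := by
  have : Nonempty (orbitHull Γ v) := ⟨v, self_mem_orbitHull v⟩
  let r : orbitHull Γ v → orbitHull Γ v → Prop := fun x y => (y : V) ∈ orbitHull Γ (x : V)
  have : Std.Refl r := ⟨fun x => self_mem_orbitHull (x : V)⟩
  obtain ⟨w, hw⟩ : ∃ w, ∀ x, r w x → r x w := by
    refine exists_maximal_of_nonempty_chains_bounded (fun c hc hne => ?_)
      fun hxy hyz => orbitHull_subset_of_mem hxy hyz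
    have := hne.to_subtype
    obtain ⟨x, hx⟩ := IsCompact.nonempty_iInter_of_directed_nonempty_isCompact_isClosed
      (fun y : c => orbitHull Γ (y : V))
      (fun y z => (hc.total y.2 z.2).elim (fun h => ⟨z, orbitHull_subset_of_mem h, subset_rfl⟩)
        fun h => ⟨y, subset_rfl, orbitHull_subset_of_mem h⟩)
      (fun y => ⟨y, self_mem_orbitHull _⟩)
      (fun y => hv.of_isClosed_subset (isClosed_orbitHull _) (orbitHull_subset_of_mem y.1.2))
      fun y => isClosed_orbitHull _
    rw [Set.mem_iInter] at hx
    exact ⟨⟨x, orbitHull_subset_of_mem hne.some.2 (hx ⟨_, hne.some_mem⟩)⟩,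
      fun y hy => hx ⟨y, hy⟩⟩
  exact ⟨w, w.2, fun x hx => hw ⟨x, orbitHull_subset_of_mem w.2 hx⟩ hx⟩

lemma IsHullMinimal.one_add_mul_apply_le [T2Space V] {u v m : V} (hv : IsHullMinimal Γ v)
    (hu : IsCompact (orbitHull Γ u)) (hvu : v ∈ orbitHull Γ u) (hm : m ∈ orbitHull Γ v)
    (F : V →L[ℝ] ℝ) {K c : ℝ} (hK : 0 ≤ K) (hc : ∀ g : Γ, F (g • u) + K * F (g • m) ≤ c) (g : Γ) :
    (1 + K) * F (g • v) ≤ c := by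
  have hmu : orbitHull Γ m ⊆ orbitHull Γ u :=
    orbitHull_subset_of_mem (orbitHull_subset_of_mem hvu hm)
  obtain ⟨w, hwm, hvw⟩ := exists_prodMk_mem_orbitHull hu
    (hu.of_isClosed_subset (isClosed_orbitHull m) hmu) hvu
  have hpair (h : Γ) : F (h • v) + K * F (h • w) ≤ c :=
    apply_le_of_mem_orbitHull (F.coprod (K • F)) hc (smul_mem_orbitHull_of_mem h hvw)
  have hK' : 0 < 1 + K := by positivity
  let z : V := (1 + K)⁻¹ • v + ((1 + K)⁻¹ * K) • w
  have hz : z ∈ orbitHull Γ v :=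
    convex_orbitHull v (self_mem_orbitHull v) (orbitHull_subset_of_mem hm hwm) (by positivity)
      (by positivity) (by field_simp)
  have hzc (h : Γ) : F (h • z) ≤ c / (1 + K) := by
    have : F (h • z) = (F (h • v) + K * F (h • w)) / (1 + K) := by
      simp only [z, smul_add, smul_comm h, map_add, map_smul, smul_eq_mul]
      ring
    rw [this]
    exact div_le_div_of_nonneg_right (hpair h) hK'.le
  rw [mul_comm, ← le_div_iff₀ hK']
  exact apply_le_of_mem_orbitHull F hzc (smul_mem_orbitHull_of_mem g (hv z hz))

lemma IsHullMinimal.exists_lt_apply_smul [T2Space V] {u v : V} (hv : IsHullMinimal Γ v)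
    (hu : IsCompact (orbitHull Γ u)) (hvu : v ∈ orbitHull Γ u) (F : V →L[ℝ] ℝ) {r : ℝ}
    (hr : r < F v) (Z : Finset Γ) (hZ : Z.Nonempty) :
    ∃ g : Γ, r < F (g • u) ∧ ∀ z ∈ Z, r < F (g • z • v) := by
  obtain ⟨b, hb⟩ := (hu.image F.continuous).bddAbove
  have hub (g : Γ) : F (g • u) ≤ b := hb ⟨_, smul_mem_orbitHull g u, rfl⟩
  have hvb : BddAbove (Set.range fun g : Γ => F (g • v)) :=
    ⟨b, by rintro _ ⟨g, rfl⟩; exact hb ⟨_, smul_mem_orbitHull_of_mem g hvu, rfl⟩⟩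
  let s := ⨆ g : Γ, F (g • v)
  have hs (g : Γ) : F (g • v) ≤ s := le_ciSup hvb g
  have hrs : r < s := hr.trans_le (by simpa only [one_smul] using hs 1)
  have hrb : r < b := hr.trans_le (hb ⟨v, hvu, rfl⟩)
  by_contra! hcon
  -- With this `C`, a loss of `s - r` at one `z ∈ Z` offsets a gain of `b - r` at `u`.
  let C := (b - r) / (s - r)
  have hC : 0 < C := div_pos (sub_pos.2 hrb) (sub_pos.2 hrs)
  have hCs : C * (s - r) = b - r := div_mul_cancel₀ _ (sub_pos.2 hrs).ne'
  obtain ⟨m, hm, hFm⟩ := exists_mem_orbitHull_card_mul_apply v hZ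
  have hbound (g : Γ) : F (g • u) + C * Z.card * F (g • m) ≤ r + C * Z.card * s := by
    have hgap : ∀ z ∈ Z, 0 ≤ s - F (g • z • v) := fun z _ =>
      sub_nonneg.2 (by simpa only [mul_smul] using hs (g * z))
    have hsum : ∑ z ∈ Z, (s - F (g • z • v)) = Z.card * s - Z.card * F (g • m) := by
      rw [hFm, Finset.sum_sub_distrib, Finset.sum_const, nsmul_eq_mul]
    obtain hg | hg := le_or_gt (F (g • u)) r
    · nlinarith [Finset.sum_nonneg hgap]
    · obtain ⟨z, hz, hzr⟩ := hcon g hg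
      nlinarith [Finset.single_le_sum hgap hz, hub g]
  have hle : s ≤ (r + C * Z.card * s) / (1 + C * Z.card) := by
    refine ciSup_le fun g => ?_
    rw [le_div_iff₀ (by positivity), mul_comm]
    exact hv.one_add_mul_apply_le hu hvu hm F (by positivity) hbound g
  rw [le_div_iff₀ (by positivity)] at hle
  linarith

end Minimal

end AffineDynamics

lemma exists_finite_approx {X α : Type*} {φ : X → α → ℝ} {s : Finset α}
    (hφ : ∀ a ∈ s, Bornology.IsBounded (Set.range fun x => φ x a)) {ε : ℝ} (hε : 0 < ε) :
    ∃ (n : ℕ) (p : X → Fin n) (q : Fin n → X), ∀ a ∈ s, ∀ x, |φ x a - φ (q (p x)) a| ≤ ε := by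
  let ψ : X → s → ℝ := fun x a => φ x a
  have hψ : Bornology.IsBounded (Set.range ψ) := by
    refine Bornology.forall_isBounded_image_eval_iff.1 fun a => ?_
    rw [← Set.range_comp]
    exact hφ a a.2
  obtain ⟨t, ht, hfin, hcover⟩ :=
    Metric.finite_approx_of_totallyBounded (hψ.isCompact_closure.totallyBounded.subset
      subset_closure) ε hε
  have := hfin.fintype
  let e := Fintype.equivFin t
  have hclose (x : X) : ∃ z : t, dist (ψ x) z < ε := by
    simpa using hcover ⟨x, rfl⟩
  choose z hz using hclose
  choose q hq using fun i => ht (e.symm i).2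
  refine ⟨Fintype.card t, fun x => e (z x), q, fun a ha x => ?_⟩
  have hqz : ψ (q (e (z x))) = z x := by rw [hq, e.symm_apply_apply]
  calc |φ x a - φ (q (e (z x))) a| = dist (ψ x ⟨a, ha⟩) (ψ (q (e (z x))) ⟨a, ha⟩) := rfl
    _ ≤ dist (ψ x) (ψ (q (e (z x)))) := dist_le_pi_dist _ _ _
    _ ≤ ε := by rw [hqz]; exact (hz x).le

namespace FinAddProb

variable {X α : Type*}

@[ext]
protected lemma ext {m m' : FinAddProb X} (h : ∀ s, m s = m' s) : m = m' := by
  cases m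
  cases m'
  congr 1
  exact MeasureTheory.AddContent.ext h

lemma apply_univ (m : FinAddProb X) : m Set.univ = 1 := m.univ'

section Integral

variable (m : FinAddProb X)

lemma abs_integral_sub_simpleSum_le {f : X → ℝ} {ι : Type} [Fintype ι] {p : X → ι} {c : ι → ℝ}
    {ε : ℝ} (h : ∀ x, |f x - c (p x)| ≤ ε) : |m.integral f - m.simpleSum p c| ≤ ε := by
  have hadd (b : ℝ) : m.simpleSum (fun x => (p x, ())) (fun z => c z.1 + b) =
      m.simpleSum p c + b := by
    rw [m.simpleSum_add p (fun _ => ()) c fun _ => b, m.simpleSum_const]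
  have hlower : m.simpleSum p c + -ε ∈ m.lowerSums f :=
    ⟨_, _, _, _, fun x => by linarith [(abs_le.1 (h x)).1], (hadd _).symm⟩
  have hupper : m.simpleSum p c + ε ∈ upperBounds (m.lowerSums f) := by
    rintro _ ⟨κ, _, q, d, hd, rfl⟩
    rw [← hadd]
    exact m.simpleSum_mono _ _ _ _ fun x => (hd x).trans (by linarith [(abs_le.1 (h x)).2])
  have h₁ : m.simpleSum p c + -ε ≤ m.integral f := le_csSup ⟨_, hupper⟩ hlower
  have h₂ : m.integral f ≤ m.simpleSum p c + ε := csSup_le ⟨_, hlower⟩ hupper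
  rw [abs_le]
  constructor <;> linarith

lemma sum_apply_fiber {ι : Type} [Fintype ι] (p : X → ι) : ∑ i, (m (p ⁻¹' {i}) : ℝ) = 1 := by
  simpa only [Set.univ_inter, apply_univ, NNReal.coe_sum, NNReal.coe_one] using
    (congrArg NNReal.toReal (m.sum_fiber p Set.univ)).symm

end Integral

lemma integral_mem_closedConvexHull (m : FinAddProb X) {φ : X → α → ℝ}
    (hφ : ∀ a, Bornology.IsBounded (Set.range fun x => φ x a)) :
    (fun a => m.integral fun x => φ x a) ∈ closedConvexHull ℝ (Set.range φ) := by
  rw [closedConvexHull_eq_closure_convexHull, mem_closure_iff_nhds]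
  intro U hU
  rw [nhds_pi, Filter.mem_pi] at hU
  obtain ⟨S, hS, t, ht, hSU⟩ := hU
  obtain ⟨ε, hεt, hε⟩ := (((Filter.eventually_all_finite hS).2 fun a _ =>
    nhdsWithin_le_nhds (eventually_closedBall_subset (ht a))).and
      (self_mem_nhdsWithin (s := Set.Ioi (0 : ℝ)))).exists
  obtain ⟨n, p, q, hpq⟩ := exists_finite_approx (s := hS.toFinset) (fun a _ => hφ a) hε
  refine ⟨∑ i, (m (p ⁻¹' {i}) : ℝ) • φ (q i), hSU fun a ha => hεt a ha ?_, ?_⟩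
  · have h := m.abs_integral_sub_simpleSum_le (c := fun i => φ (q i) a)
      (hpq a (hS.mem_toFinset.2 ha))
    rw [abs_sub_comm] at h
    simpa [simpleSum, mul_comm, Real.dist_eq] using h
  · exact (convex_convexHull ℝ _).sum_mem (fun _ _ => NNReal.coe_nonneg _) (m.sum_apply_fiber p)
      fun i _ => subset_convexHull ℝ _ ⟨q i, rfl⟩

lemma simpleSum_dirac (x : X) {ι : Type} [Fintype ι] (p : X → ι) (c : ι → ℝ) :
    (dirac x).simpleSum p c = c (p x) := by
  classical
  have happly (s : Set X) : dirac x s = if x ∈ s then 1 else 0 := by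
    unfold dirac; congr
  simp [simpleSum, happly, apply_ite NNReal.toReal]

lemma integral_dirac (x : X) {f : X → ℝ} (hf : BddBelow (Set.range f)) :
    (dirac x).integral f = f x := by
  classical
  have hupper : f x ∈ upperBounds ((dirac x).lowerSums f) := by
    rintro _ ⟨ι, _, p, c, hc, rfl⟩
    rw [simpleSum_dirac]
    exact hc x
  obtain ⟨b, hb⟩ := hf
  have hmem : f x ∈ (dirac x).lowerSums f := by
    refine ⟨Bool, inferInstance, fun y => decide (y = x), fun i => if i then f x else b,
      fun y => ?_, by simp [simpleSum_dirac]⟩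
    by_cases hy : y = x
    · simp [hy]
    · simpa [hy] using hb ⟨y, rfl⟩
  exact IsGreatest.csSup_eq ⟨hmem, hupper⟩

section Conv

variable {Γ : Type*} [Group Γ] [MulAction Γ X]

lemma dirac_conv_apply (g : Γ) (m : FinAddProb X) (A : Set X) :
    (dirac g).conv m A = m (g⁻¹ • A) :=
  NNReal.eq (integral_dirac g ⟨0, by rintro _ ⟨h, rfl⟩; exact NNReal.coe_nonneg _⟩)

lemma dirac_one_conv (m : FinAddProb X) : (dirac (1 : Γ)).conv m = m := by
  ext A
  rw [dirac_conv_apply, inv_one, one_smul]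

end Conv

end FinAddProb

section Recurrence

open DomMulAct

variable {X : Type*} {Γ : Type*} [Group Γ] [MulAction Γ X]

instance : ContinuousConstSMul Γᵈᵐᵃ (Set X → ℝ) where
  continuous_const_smul _ := continuous_pi fun _ => continuous_apply _

namespace FinAddProb

/-- A finitely additive probability measure as a point of the product space `Set X → ℝ`, on which
`Γ` acts through `Γᵈᵐᵃ` by `(mk g • v) A = v (g • A)`. -/
def toRealFun (m : FinAddProb X) : Set X → ℝ := fun A => m A

lemma mem_range_toRealFun {v : Set X → ℝ} : v ∈ Set.range toRealFun ↔
    (∀ A, 0 ≤ v A) ∧ v Set.univ = 1 ∧ ∀ A B, Disjoint A B → v (A ∪ B) = v A + v B := by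
  constructor
  · rintro ⟨m, rfl⟩
    refine ⟨fun A => NNReal.coe_nonneg _, ?_, fun A B h => ?_⟩
    · simp [toRealFun, m.apply_univ]
    · simp [toRealFun, m.union h]
  · rintro ⟨h0, h1, hadd⟩
    have hempty : v ∅ = 0 := by simpa using hadd ∅ ∅ (Set.disjoint_empty _)
    exact ⟨ofUnion (fun A => ⟨v A, h0 A⟩) (NNReal.eq hempty) (NNReal.eq h1)
      fun A B h => NNReal.eq (hadd A B h), rfl⟩

lemma convex_range_toRealFun : Convex ℝ (Set.range (toRealFun (X := X))) := by
  intro v hv w hw a b ha hb hab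
  rw [mem_range_toRealFun] at hv hw ⊢
  obtain ⟨hv0, hv1, hvU⟩ := hv
  obtain ⟨hw0, hw1, hwU⟩ := hw
  refine ⟨fun A => ?_, ?_, fun A B h => ?_⟩
  · have := hv0 A
    have := hw0 A
    simp only [Pi.add_apply, Pi.smul_apply, smul_eq_mul]
    positivity
  · simp [hv1, hw1, hab]
  · simp only [Pi.add_apply, Pi.smul_apply, smul_eq_mul, hvU A B h, hwU A B h]
    ring

lemma isCompact_range_toRealFun : IsCompact (Set.range (toRealFun (X := X))) := by
  refine (isCompact_univ_pi fun _ => isCompact_Icc (a := (0 : ℝ)) (b := 1)).of_isClosed_subset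
    ?_ ?_
  · have : Set.range (toRealFun (X := X)) = {v | (∀ A, 0 ≤ v A) ∧ v Set.univ = 1 ∧
        ∀ A B, Disjoint A B → v (A ∪ B) = v A + v B} := Set.ext fun _ => mem_range_toRealFun
    rw [this]
    simp only [Set.ofPred_and, Set.ofPred_forall]
    refine (isClosed_iInter fun A => isClosed_le ?_ ?_).inter <| (isClosed_eq ?_ ?_).inter <|
      isClosed_iInter fun A => isClosed_iInter fun B => isClosed_iInter fun _ => isClosed_eq ?_ ?_
    all_goals fun_prop
  · rintro _ ⟨m, rfl⟩ A -
    exact ⟨NNReal.coe_nonneg _, by exact_mod_cast m.le_one A⟩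

lemma smul_toRealFun_mem_range (g : Γᵈᵐᵃ) (m : FinAddProb X) :
    g • m.toRealFun ∈ Set.range (toRealFun (X := X)) := by
  obtain ⟨h0, h1, hU⟩ := mem_range_toRealFun.1 ⟨m, rfl⟩
  refine mem_range_toRealFun.2 ⟨fun A => h0 _, ?_, fun A B h => ?_⟩
  · rw [DomMulAct.smul_apply, Set.smul_set_univ, h1]
  · simp only [DomMulAct.smul_apply, Set.smul_set_union]
    exact hU _ _ ((Set.disjoint_image_iff (MulAction.injective _)).2 h)

lemma orbitHull_toRealFun_subset_range (m : FinAddProb X) :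
    orbitHull Γᵈᵐᵃ m.toRealFun ⊆ Set.range (toRealFun (X := X)) :=
  orbitHull_subset convex_range_toRealFun isCompact_range_toRealFun.isClosed
    fun g => smul_toRealFun_mem_range g m

lemma isCompact_orbitHull_toRealFun (m : FinAddProb X) :
    IsCompact (orbitHull Γᵈᵐᵃ m.toRealFun) :=
  isCompact_range_toRealFun.of_isClosed_subset (isClosed_orbitHull _)
    m.orbitHull_toRealFun_subset_range

lemma conv_toRealFun_mem_orbitHull (l : FinAddProb Γ) (m : FinAddProb X) :
    (l.conv m).toRealFun ∈ orbitHull Γᵈᵐᵃ m.toRealFun := by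
  have h : (l.conv m).toRealFun ∈
      closedConvexHull ℝ (Set.range fun g : Γ => DomMulAct.mk g⁻¹ • m.toRealFun) :=
    l.integral_mem_closedConvexHull fun A => (Metric.isBounded_Icc (0 : ℝ) 1).subset <| by
      rintro _ ⟨g, rfl⟩
      exact ⟨NNReal.coe_nonneg _, by exact_mod_cast m.le_one _⟩
  refine closedConvexHull_min ?_ (convex_orbitHull _) (isClosed_orbitHull _) h
  rintro _ ⟨g, rfl⟩
  exact smul_mem_orbitHull _ _

end FinAddProb

/-- A simultaneous recurrence property of two measures: whenever `ν A > r`, a single translation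
`A ↦ y A` makes `μ (y A)` and any finite number of the values `ν (z y A)` greater than `r`. -/
def IsJointlyRecurrent (Γ : Type*) [Group Γ] [MulAction Γ X] (μ ν : FinAddProb X) : Prop :=
  ∀ (A : Set X) (r : ℝ), r < ν A → ∀ Z : Finset Γ, ∃ y : Γ, r < μ (y • A) ∧
    ∀ z ∈ Z, r < ν (z • y • A)

variable {I : Order.Ideal (Set X)}

lemma orbitHull_toRealFun_apply_eq_zero (hI : IsGInvariant Γ I) {m : FinAddProb X}
    (hm : m ∈ nullMeasures I) {v : Set X → ℝ} (hv : v ∈ orbitHull Γᵈᵐᵃ m.toRealFun) {A : Set X}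
    (hA : A ∈ I) : v A = 0 := by
  refine orbitHull_subset (s := (LinearMap.proj A : (Set X → ℝ) →ₗ[ℝ] ℝ) ⁻¹' {0})
    ((convex_singleton 0).linear_preimage _) (isClosed_singleton.preimage (continuous_apply A))
    (fun g => ?_) hv
  exact congrArg NNReal.toReal (hm _ (hI (mk.symm g) A hA))

lemma exists_isJointlyRecurrent (hI : IsGInvariant Γ I) {μ : FinAddProb X} {l : FinAddProb Γ}
    (hl : l.conv μ ∈ nullMeasures I) : ∃ ν ∈ nullMeasures I, IsJointlyRecurrent Γ μ ν := by
  classical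
  obtain ⟨v, hvl, hv⟩ := exists_isHullMinimal (l.conv μ).isCompact_orbitHull_toRealFun (Γ := Γᵈᵐᵃ)
  have hvμ : v ∈ orbitHull Γᵈᵐᵃ μ.toRealFun :=
    orbitHull_subset_of_mem (l.conv_toRealFun_mem_orbitHull μ) hvl
  obtain ⟨ν, rfl⟩ := (l.conv μ).orbitHull_toRealFun_subset_range hvl
  refine ⟨ν, fun A hA => NNReal.eq (orbitHull_toRealFun_apply_eq_zero hI hl hvl hA),
    fun A r hr Z => ?_⟩
  obtain ⟨g, hgμ, hgν⟩ := hv.exists_lt_apply_smul μ.isCompact_orbitHull_toRealFun hvμ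
    (ContinuousLinearMap.proj A) hr (insert 1 (Z.map mk.toEmbedding)) (Finset.insert_nonempty _ _)
  exact ⟨mk.symm g, hgμ, fun z hz =>
    hgν (mk z) (Finset.mem_insert_of_mem (Finset.mem_map_of_mem _ hz))⟩

end Recurrence

namespace FinAddProb

variable {X ι : Type*}

lemma apply_biUnion_le (m : FinAddProb X) (F : Finset ι) (s : ι → Set X) :
    m (⋃ i ∈ F, s i) ≤ ∑ i ∈ F, m (s i) :=
  MeasureTheory.addContent_biUnion_le (m := m.toAddContent) isSetRing_univ fun _ _ => trivial

lemma union_of_inter_null (m : FinAddProb X) {s t : Set X} (h : m (s ∩ t) = 0) :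
    m (s ∪ t) = m s + m t := by
  have ht : m t = m (t \ s) := by
    conv_lhs => rw [← Set.sdiff_union_inter t s]
    rw [m.union Set.disjoint_sdiff_inter, Set.inter_comm, h, add_zero]
  rw [ht, ← m.union Set.disjoint_sdiff_right, Set.union_sdiff_self]

lemma biUnion_of_pairwise_null (m : FinAddProb X) {F : Finset ι} {s : ι → Set X}
    (h : (F : Set ι).Pairwise fun i j => m (s i ∩ s j) = 0) :
    m (⋃ i ∈ F, s i) = ∑ i ∈ F, m (s i) := by
  classical
  induction F using Finset.induction_on with
  | empty => simp [m.empty]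
  | insert j F hj ih =>
    rw [Finset.coe_insert] at h
    have hinter : m (s j ∩ ⋃ i ∈ F, s i) = 0 := by
      rw [Set.inter_iUnion₂, ← nonpos_iff_eq_zero]
      refine (m.apply_biUnion_le F fun i => s j ∩ s i).trans (Finset.sum_nonpos fun i hi => ?_)
      exact (h (Set.mem_insert _ _) (Set.mem_insert_of_mem _ hi)
        fun hji => hj (hji ▸ hi)).le
    rw [Finset.set_biUnion_insert, m.union_of_inter_null hinter, Finset.sum_insert hj,
      ih (h.mono (Set.subset_insert _ _))]

lemma one_le_sum_of_compl_null [Fintype ι] (m : FinAddProb X) {s : ι → Set X}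
    (h : m (⋃ i, s i)ᶜ = 0) : 1 ≤ ∑ i, m (s i) := by
  calc 1 = m (⋃ i, s i) := by
        rw [← m.apply_univ, ← Set.union_compl_self (⋃ i, s i), m.union disjoint_compl_right, h,
          add_zero]
    _ ≤ ∑ i, m (s i) := by simpa using m.apply_biUnion_le Finset.univ s

end FinAddProb

section Packing

variable {G : Type*} [Group G] {X : Type*} [MulAction G X] {I : Order.Ideal (Set X)} {A : Set X}

lemma smul_inter_smul_mem (hGI : IsGInvariant G I) {f g : G} (h : f⁻¹ * g ∉ diffSet G I A) :
    g • A ∩ f • A ∈ I := by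
  have hfg : (f⁻¹ * g) • A ∩ A ∈ I := of_not_not h
  simpa only [Set.smul_set_inter, smul_smul, mul_inv_cancel_left] using hGI f _ hfg

/-- The translates of `A` by the elements of `F` are pairwise disjoint modulo `I`. -/
def IsPacking (I : Order.Ideal (Set X)) (A : Set X) (F : Finset G) : Prop :=
  (F : Set G).Pairwise fun f g => f • A ∩ g • A ∈ I

lemma IsPacking.insert [DecidableEq G] (hGI : IsGInvariant G I) {F : Finset G}
    (hF : IsPacking I A F) {g : G} (hg : g ∉ (F : Set G) * diffSet G I A) :
    IsPacking I A (insert g F) := by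
  have hmem : ∀ f ∈ F, g • A ∩ f • A ∈ I := fun f hf =>
    smul_inter_smul_mem hGI fun hfg => hg ⟨f, hf, _, hfg, mul_inv_cancel_left f g⟩
  rw [IsPacking, Finset.coe_insert]
  refine Set.Pairwise.insert hF fun f hf _ => ⟨hmem f hf, ?_⟩
  rw [Set.inter_comm]
  exact hmem f hf

lemma exists_isPacking (hGI : IsGInvariant G I) (hA : A ∉ I) {S : Set G} {n : ℕ}
    (h : ∀ F : Finset G, (F : Set G) ⊆ S → F.card < n →
      ∃ g ∈ S, g ∉ (F : Set G) * diffSet G I A) :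
    ∃ F : Finset G, (F : Set G) ⊆ S ∧ F.card = n ∧ IsPacking I A F := by
  classical
  induction n with
  | zero => exact ⟨∅, by simp [IsPacking]⟩
  | succ n ih =>
    obtain ⟨F, hFS, hFn, hF⟩ := ih fun F hFS hFn => h F hFS (by omega)
    obtain ⟨g, hgS, hg⟩ := h F hFS (by omega)
    have hone : (1 : G) ∈ diffSet G I A := by simpa [diffSet] using hA
    have hgF : g ∉ F := fun hgF => hg ⟨g, hgF, 1, hone, mul_one g⟩
    refine ⟨insert g F, ?_, ?_, hF.insert hGI hg⟩
    · rw [Finset.coe_insert]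
      exact Set.insert_subset hgS hFS
    · rw [Finset.card_insert_of_notMem hgF, hFn]

lemma IsPacking.exists_apply_le {F : Finset G} (hF : IsPacking I A F) (hne : F.Nonempty)
    {ν : FinAddProb X} (hν : ν ∈ nullMeasures I) :
    ∃ g ∈ F, (ν (g • A) : ℝ) ≤ 1 / (F.card : ℝ) := by
  refine Finset.exists_le_of_sum_le hne ?_
  have hsum := ν.biUnion_of_pairwise_null fun f hf g hg hfg => hν _ (hF hf hg hfg)
  have hle : ∑ g ∈ F, ν (g • A) ≤ 1 := hsum ▸ ν.le_one _
  have hcard : (F.card : ℝ) ≠ 0 := by exact_mod_cast hne.card_pos.ne'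
  rw [Finset.sum_const, nsmul_eq_mul, mul_one_div_cancel hcard]
  exact_mod_cast hle

end Packing

section Covering

variable {G : Type*} [Group G]

lemma cov_le_card {B : Set G} {F : Finset G} (h : (F : Set G) * B = Set.univ) :
    cov B ≤ (F.card : WithTop Cardinal) :=
  (iInf₂_le (F : Set G) h).trans (by simp)

lemma covIdeal_le_card {J : Order.Ideal (Set G)} {B : Set G} {F : Finset G}
    (h : ((F : Set G) * B)ᶜ ∈ J) : covIdeal J B ≤ (F.card : WithTop Cardinal) := by
  have h' : symmDiff ((F : Set G) * B) Set.univ ∈ J := by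
    rwa [← Set.top_eq_univ, symmDiff_top]
  exact (iInf₂_le (F : Set G) h').trans (by simp)

/-- The `G`-invariant ideal generated by a set `N`: the sets covered by finitely many translates
of `N`. -/
def translateIdeal (N : Set G) : Order.Ideal (Set G) where
  carrier := {B | ∃ E : Finset G, B ⊆ ⋃ e ∈ E, e • N}
  lower' := by
    rintro B C hCB ⟨E, hE⟩
    exact ⟨E, Set.Subset.trans hCB hE⟩
  nonempty' := ⟨∅, ∅, Set.empty_subset _⟩
  directed' := by
    classical
    rintro B ⟨E, hE⟩ C ⟨F, hF⟩
    refine ⟨B ∪ C, ⟨E ∪ F, ?_⟩, Set.subset_union_left, Set.subset_union_right⟩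
    rw [Finset.set_biUnion_union]
    exact Set.union_subset_union hE hF

lemma self_mem_translateIdeal (N : Set G) : N ∈ translateIdeal N :=
  ⟨{1}, by simp⟩

lemma isGInvariant_translateIdeal (N : Set G) : IsGInvariant G (translateIdeal N) := by
  classical
  rintro g B ⟨E, hE⟩
  refine ⟨E.image (g * ·), ?_⟩
  rw [Finset.set_biUnion_finset_image]
  rintro _ ⟨b, hb, rfl⟩
  obtain ⟨e, he, hbe⟩ := Set.mem_iUnion₂.1 (hE hb)
  refine Set.mem_iUnion₂.2 ⟨e, he, ?_⟩
  rw [mul_smul]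
  exact Set.smul_mem_smul_set hbe

lemma exists_finset_of_forall_le_covIdeal {S B : Set G} {n : ℕ}
    (h : ∀ J : Order.Ideal (Set G), J.IsProper → IsGInvariant G J → S ∉ J →
      (n : WithTop Cardinal) ≤ covIdeal J B) {F : Finset G} (hF : F.card < n) :
    ∃ E : Finset G, ∀ y ∈ S, ∃ e ∈ E, e⁻¹ * y ∉ (F : Set G) * B := by
  have hS : S ∈ translateIdeal ((F : Set G) * B)ᶜ := by
    by_contra hS
    have hle := (h _ (Order.Ideal.isProper_of_notMem hS) (isGInvariant_translateIdeal _) hS).trans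
      (covIdeal_le_card (self_mem_translateIdeal _))
    exact hF.not_ge (by exact_mod_cast hle)
  obtain ⟨E, hE⟩ := hS
  refine ⟨E, fun y hy => ?_⟩
  obtain ⟨e, he, hye⟩ := Set.mem_iUnion₂.1 (hE hy)
  exact ⟨e, he, Set.mem_smul_set_iff_inv_smul_mem.1 hye⟩

end Covering

section LargeTranslates

variable {G : Type*} [Group G] {X : Type*} [MulAction G X] {I : Order.Ideal (Set X)}

lemma exists_finset_apply_le_of_lt_cov (hGI : IsGInvariant G I) {A : Set X} {n : ℕ}
    (h : (n : WithTop Cardinal) < cov (diffSet G I A)) :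
    ∃ F : Finset G, ∀ ν ∈ nullMeasures I, ∃ f ∈ F, (ν (f • A) : ℝ) ≤ 1 / (n + 1) := by
  by_cases hA : A ∈ I
  · refine ⟨{1}, fun ν hν => ⟨1, Finset.mem_singleton_self 1, ?_⟩⟩
    rw [one_smul, hν A hA, NNReal.coe_zero]
    positivity
  · obtain ⟨F, -, hFn, hF⟩ : ∃ F : Finset G, (F : Set G) ⊆ Set.univ ∧ F.card = n + 1 ∧
        IsPacking I A F := by
      refine exists_isPacking hGI hA fun F _ hFn => ?_
      by_contra! hcover
      refine h.not_ge ((cov_le_card (Set.eq_univ_of_forall fun g => hcover g trivial)).trans ?_)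
      exact_mod_cast Nat.lt_succ_iff.1 hFn
    refine ⟨F, fun ν hν => ?_⟩
    simpa only [hFn, Nat.cast_add_one] using
      hF.exists_apply_le (Finset.card_pos.1 (by omega)) hν

lemma exists_finset_lt_apply_of_lt_cov (hGI : IsGInvariant G I) {ι : Type*} [Fintype ι]
    {A : ι → Set X} (hA : (⋃ i, A i)ᶜ ∈ I) {i : ι}
    (h : (Fintype.card ι : WithTop Cardinal) < cov (diffSet G I (A i))) :
    ∃ F : Finset G, ∀ ν ∈ nullMeasures I, ∃ f ∈ F, ∃ j,
      1 / (Fintype.card ι : ℝ) < ν (f • A j) := by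
  obtain ⟨F, hF⟩ := exists_finset_apply_le_of_lt_cov hGI h
  refine ⟨F, fun ν hν => ?_⟩
  obtain ⟨f, hfF, hf⟩ := hF ν hν
  refine ⟨f, hfF, ?_⟩
  have hn : (0 : ℝ) < Fintype.card ι := by exact_mod_cast Fintype.card_pos_iff.2 ⟨i⟩
  have hnull : ν (⋃ j, f • A j)ᶜ = 0 := by
    rw [← Set.smul_set_iUnion, ← Set.smul_set_compl]
    exact hν _ (hGI f _ hA)
  have hone : (1 : ℝ) ≤ ∑ j, (ν (f • A j) : ℝ) := by
    exact_mod_cast ν.one_le_sum_of_compl_null hnull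
  by_contra! hsmall
  have hlt : ∑ j, (ν (f • A j) : ℝ) < ∑ _j : ι, 1 / (Fintype.card ι : ℝ) :=
    Finset.sum_lt_sum (fun j _ => hsmall j) ⟨i, Finset.mem_univ i, hf.trans_lt (by gcongr; simp)⟩
  rw [Finset.sum_const, Finset.card_univ, nsmul_eq_mul, mul_one_div_cancel hn.ne'] at hlt
  exact hone.not_gt hlt

lemma IsJointlyRecurrent.exists_forall_mem_mul_diffSet {H : Subgroup G} {μ ν : FinAddProb X}
    (hrec : IsJointlyRecurrent H μ ν) (hν : ν ∈ nullMeasures I) (hGI : IsGInvariant G I)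
    {A : Set X} {n : ℕ} (hn : n ≠ 0) {f : G} (hfH : f ∈ H) (hf : 1 / (n : ℝ) < ν (f • A))
    {E : Finset G → Finset G} (hE : ∀ F : Finset G, (F : Set G) ⊆ H → (E F : Set G) ⊆ H) :
    ∃ F : Finset G, F.card < n ∧ ∃ y : G, 1 / (n : ℝ) < μ (y • A) ∧
      ∀ e ∈ E F, e⁻¹ * y ∈ (F : Set G) * diffSet G I A := by
  classical
  by_contra! hcon
  have hA : A ∉ I := fun hA => by
    rw [hν _ (hGI f A hA), NNReal.coe_zero] at hf
    exact hf.not_ge (by positivity)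
  obtain ⟨F, hFS, hFn, hF⟩ : ∃ F : Finset G,
      (F : Set G) ⊆ {g | g ∈ H ∧ 1 / (n : ℝ) < ν (g • A)} ∧ F.card = n ∧ IsPacking I A F := by
    refine exists_isPacking hGI hA fun F hFS hFn => ?_
    have hEF := hE F fun g hg => (hFS hg).1
    obtain ⟨y, hyμ, hyν⟩ := hrec (f • A) _ hf (((E F).subtype (· ∈ H)).image (·⁻¹))
    obtain ⟨e, he, hey⟩ := hcon F hFn (y * f) (by rwa [mul_smul])
    refine ⟨e⁻¹ * (y * f), ⟨?_, ?_⟩, hey⟩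
    · exact H.mul_mem (H.inv_mem (hEF he)) (H.mul_mem y.2 hfH)
    · rw [mul_smul, mul_smul]
      exact hyν (⟨e, hEF he⟩⁻¹) (Finset.mem_image_of_mem _ (Finset.mem_subtype.2 he))
  obtain ⟨g, hgF, hg⟩ := hF.exists_apply_le (Finset.card_pos.1 (by omega)) hν
  rw [hFn] at hg
  exact hg.not_gt (hFS hgF).2

end LargeTranslates

section ClosedSubgroups

variable {G : Type*} [Group G]

lemma countable_closure_of_countable {s : Set G} (hs : s.Countable) :
    Countable (Subgroup.closure s) := by
  have := hs.to_subtype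
  have h := FreeGroup.range_lift_eq_closure (f := ((↑) : s → G))
  rw [Subtype.range_coe] at h
  rw [← h]
  exact (Set.countable_range _).to_subtype

/-- The countable subgroups closed under an operation that assigns to each finite subset of `G` a
set of further elements; such operations provide the closed dominating families to which
stationarity is applied. -/
def closedSubgroups (E : Finset G → Set G) : Set (Subgroup G) :=
  {H | Countable H ∧ ∀ F : Finset G, (F : Set G) ⊆ H → E F ⊆ H}

lemma exists_subset_of_subset_iUnion {s : ℕ → Subgroup G} (hs : Monotone s) {F : Finset G}
    (hF : (F : Set G) ⊆ ⋃ k, (s k : Set G)) : ∃ k, (F : Set G) ⊆ s k := by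
  have hdir : Directed (· ⊆ ·) fun k => (s k : Set G) :=
    Monotone.directed_le fun _ _ h => hs h
  exact hdir.exists_mem_subset_of_finset_subset_biUnion hF

lemma mem_closedSubgroups_of_eq_iUnion {E : Finset G → Set G} {s : ℕ → Subgroup G}
    (hs : Monotone s) (hcount : ∀ k, Countable (s k))
    (hE : ∀ k (F : Finset G), (F : Set G) ⊆ s k → ∃ m, E F ⊆ s m) {K : Subgroup G}
    (hK : (K : Set G) = ⋃ k, (s k : Set G)) : K ∈ closedSubgroups E := by
  refine ⟨?_, fun F hF => ?_⟩
  · have : (K : Set G).Countable := by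
      rw [hK]
      exact Set.countable_iUnion fun k => Set.countable_coe_iff.1 (hcount k)
    exact this.to_subtype
  · rw [hK] at hF ⊢
    obtain ⟨k, hk⟩ := exists_subset_of_subset_iUnion hs hF
    obtain ⟨m, hm⟩ := hE k F hk
    exact hm.trans (Set.subset_iUnion (fun k => (s k : Set G)) m)

lemma isClosedFamily_closedSubgroups (E : Finset G → Set G) :
    IsClosedFamily (closedSubgroups E) := fun _ hs hsE _ hK =>
  mem_closedSubgroups_of_eq_iUnion hs (fun k => (hsE k).1)
    (fun k F hF => ⟨k, (hsE k).2 F hF⟩) hK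

/-- One step of the closure of `H` under the operation `E`; iterating it gives the least member of
`closedSubgroups E` above a countable `H`. -/
def closureStep (E : Finset G → Set G) (H : Subgroup G) : Subgroup G :=
  Subgroup.closure (H ∪ ⋃ F ∈ {F : Finset G | (F : Set G) ⊆ H}, E F)

lemma le_closureStep (E : Finset G → Set G) (H : Subgroup G) : H ≤ closureStep E H :=
  fun _ hx => Subgroup.subset_closure (Or.inl hx)

lemma subset_closureStep {E : Finset G → Set G} {H : Subgroup G} {F : Finset G}
    (hF : (F : Set G) ⊆ H) : E F ⊆ closureStep E H :=
  fun _ hx => Subgroup.subset_closure (Or.inr (Set.mem_iUnion₂.2 ⟨F, hF, hx⟩))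

lemma countable_closureStep {E : Finset G → Set G} (hE : ∀ F, (E F).Countable) {H : Subgroup G}
    (hH : Countable H) : Countable (closureStep E H) := by
  have hfin : {F : Finset G | (F : Set G) ⊆ H}.Countable :=
    ((Set.countable_ofPred_finite_subset (Set.countable_coe_iff.1 hH)).preimage
      Finset.coe_injective).mono fun F hF => And.intro F.finite_toSet hF
  exact countable_closure_of_countable
    ((Set.countable_coe_iff.1 hH).union (hfin.biUnion fun F _ => hE F))

lemma isDominatingFamily_closedSubgroups {E : Finset G → Set G} (hE : ∀ F, (E F).Countable) :
    IsDominatingFamily (closedSubgroups E) := by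
  intro H hH
  let s : ℕ → Subgroup G := fun k => (closureStep E)^[k] H
  have hsucc (k : ℕ) : s (k + 1) = closureStep E (s k) := Function.iterate_succ_apply' _ _ _
  have hmono : Monotone s := monotone_nat_of_le_succ fun k => by
    rw [hsucc]
    exact le_closureStep E (s k)
  have hcount (k : ℕ) : Countable (s k) := by
    induction k with
    | zero => exact hH
    | succ k ih => exact hsucc k ▸ countable_closureStep hE ih
  exact ⟨⨆ k, s k, mem_closedSubgroups_of_eq_iUnion hmono hcount
    (fun k F hF => ⟨k + 1, hsucc k ▸ subset_closureStep hF⟩)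
    (Subgroup.coe_iSup_of_directed hmono.directed_le), le_iSup s 0⟩

lemma IsStationaryFamily.exists_mem_forall_subset {𝓕 : Set (Subgroup G)}
    (h𝓕 : IsStationaryFamily 𝓕) {E : Finset G → Set G} (hE : ∀ F, (E F).Countable) :
    ∃ H ∈ 𝓕, ∀ F : Finset G, (F : Set G) ⊆ H → E F ⊆ H := by
  obtain ⟨H, hH, hHE⟩ := h𝓕 (closedSubgroups E) (fun _ h => h.1)
    (isClosedFamily_closedSubgroups E) (isDominatingFamily_closedSubgroups hE)
  exact ⟨H, hH, hHE.2⟩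

lemma IsStationaryFamily.mono {𝓕 𝓕' : Set (Subgroup G)} (h𝓕 : IsStationaryFamily 𝓕)
    (h : 𝓕 ⊆ 𝓕') : IsStationaryFamily 𝓕' := fun C hC hclosed hdom =>
  (h𝓕 C hC hclosed hdom).mono (Set.inter_subset_inter_left C h)

end ClosedSubgroups

end IdealGSpace

theorem theorem5_general {G : Type*} [Group G] {X : Type*} [MulAction G X]
    {I : Order.Ideal (Set X)} (hGI : IsGInvariant G I) {μ : FinAddProb X}
    (hμ : IsStationaryFamily {H : Subgroup G | ∃ l : FinAddProb H, l.conv μ ∈ nullMeasures I})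
    {ι : Type*} [Fintype ι] {A : ι → Set X} (hA : (⋃ i, A i)ᶜ ∈ I) :
    (∀ i, cov (diffSet G I (A i)) ≤ (Fintype.card ι : WithTop Cardinal)) ∨
    ∃ i, ∃ J : Order.Ideal (Set G), J.IsProper ∧ IsGInvariant G J ∧
      {x : G | (μ (x • A i) : ℝ) > 1 / (Fintype.card ι : ℝ)} ∉ J ∧
      covIdeal J (diffSet G I (A i)) < (Fintype.card ι : WithTop Cardinal) := by
  by_contra! hcon
  obtain ⟨⟨i, hi⟩, hJ⟩ := hcon
  obtain ⟨F₀, hF₀⟩ := exists_finset_lt_apply_of_lt_cov hGI hA hi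
  choose! E hE using fun j F hF => exists_finset_of_forall_le_covIdeal (hJ j) (F := F) hF
  obtain ⟨H, ⟨l, hl⟩, hHE⟩ := hμ.exists_mem_forall_subset (E := fun F => F₀ ∪ ⋃ j, (E j F : Set G))
    fun F => F₀.countable_toSet.union (Set.countable_iUnion fun j => (E j F).countable_toSet)
  have hF₀H : (F₀ : Set G) ⊆ H := Set.subset_union_left.trans (hHE ∅ (by simp))
  have hEH (j : ι) (F : Finset G) (hF : (F : Set G) ⊆ H) : (E j F : Set G) ⊆ H :=
    (Set.subset_iUnion (fun j => (E j F : Set G)) j).trans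
      (Set.subset_union_right.trans (hHE F hF))
  obtain ⟨ν, hν, hrec⟩ := exists_isJointlyRecurrent (Γ := H) (fun h => hGI h) hl
  obtain ⟨f, hf, j, hfj⟩ := hF₀ ν hν
  obtain ⟨F, hF, y, hy, hyF⟩ := hrec.exists_forall_mem_mul_diffSet hν hGI
    (Fintype.card_pos_iff.2 ⟨i⟩).ne' (hF₀H hf) hfj (hEH j)
  obtain ⟨e, he, hey⟩ := hE j F hF y hy
  exact hey (hyF e he)

theorem theorem5 {G : Type*} [Group G] {X : Type*} [MulAction G X]
    (I : Order.Ideal (Set X)) (hI : I.IsProper) (hGI : IsGInvariant G I)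
    (μ : FinAddProb X)
    (hμ : IsStationaryFamily
      {H : Subgroup G | H ∈ countableSubgroups G ∧ (convNullMeasures I H μ).Nonempty})
    (n : ℕ) (A : Fin n → Set X) (hdisj : Pairwise fun i j => Disjoint (A i) (A j))
    (hA : ⋃ i, A i = Set.univ) :
    (∀ i, cov (diffSet G I (A i)) ≤ (n : WithTop Cardinal)) ∨
    ∃ i, ∃ J : Order.Ideal (Set G), J.IsProper ∧ IsGInvariant G J ∧
      {x : G | (μ (x • A i) : ℝ) > 1 / (n : ℝ)} ∉ J ∧
      covIdeal J (diffSet G I (A i)) < (n : WithTop Cardinal) := by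
  simpa only [Fintype.card_fin] using theorem5_general hGI (A := A)
    (hμ.mono fun H ⟨_, l, hl⟩ => ⟨l, by simpa only [FinAddProb.dirac_one_conv] using hl 1⟩)
    (by simpa [hA] using I.bot_mem)
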